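/- Place the viewpoint at the origin of $\mathbb R^3$ and let $Z=(Z_{ij})_{i,j\in\mathbb Z}$ be arbitrary real elevations; the grid point in row $i$ and column $j$ is $p(i,j)=(j,-i,Z_{ij})$, and it belongs to layer $\max(|i|,|j|)$. For $l\ge 1$ let $S=S_l(Z)$ be the set of all line segments that join two grid points of the same layer, this layer being one of $1,\dots,l$, that are adjacent in the grid (i.e. differ by $1$ in exactly one of row and column). Thus $S$ consists of the edges of the $l$ concentric square layers around the viewpoint. Project the points $p=(p_x,p_y,p_z)$ of these segments to the view screen $\{|x|+|y|=1\}\times\mathbb R$ by $p\mapsto p/(|p_x|+|p_y|)$. The horizon of $S$ is the upper envelope of the projected segments, that is, the function $H$ on $[0,4]$ for which $H(t)$ is the maximum of $p_z/(|p_x|+|p_y|)$ over all points $p$ of segments of $S$ such that $p_x/(|p_x|+|p_y|)=1-t$ and $p_y\le 0$ if $t\in[0,2]$, respectively $p_x/(|p_x|+|p_y|)=t-3$ and $p_y\ge 0$ if $t\in[2,4]$. Its complexity is the least number $k$ of intervals into which $[0,4]$ can be cut so that on each closed interval the graph of $H$ is part of the projection of a single segment of $S$ (so that it is a line segment there). Then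 these maxima exist, and the horizon of $S$ has complexity $O(l^2)$ in the worst case: there is an absolute constant $C$ such that for every $l\ge 1$ and all elevations $Z$ the horizon of $S_l(Z)$ has complexity at most $C\,l^2$. In particular, the complexity is at most linear in the number $(2l+1)^2$ of grid points of the square region. -/

import Mathlib

namespace GridHorizon

/-- Points of space, written `(x, y, z)` with `z` the vertical coordinate. The viewpoint is the
origin. -/
abbrev Point : Type := ℝ × ℝ × ℝ

/-- The grid point in row `a.1` and column `a.2`: rows run from north to south, columns from west
to east, the viewpoint sits at row `0` and column `0`, and `Z` is the matrix of elevations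
relative to the viewpoint. -/
def gridPoint (Z : ℤ → ℤ → ℝ) (a : ℤ × ℤ) : Point := ((a.2 : ℝ), -(a.1 : ℝ), Z a.1 a.2)

/-- The layer of a grid position: its horizontal `L_∞`-distance from the viewpoint. -/
def layerIndex (a : ℤ × ℤ) : ℕ := max a.1.natAbs a.2.natAbs

/-- The edges of the layers `1, …, l`: the segments in space that join two grid points of the same
layer which are horizontal or vertical neighbours in the grid. -/
def layerEdges (Z : ℤ → ℤ → ℝ) (l : ℕ) : Set (Set Point) :=
  {e | ∃ a b : ℤ × ℤ, 1 ≤ layerIndex a ∧ layerIndex a ≤ l ∧ layerIndex b = layerIndex a ∧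
    |a.1 - b.1| + |a.2 - b.2| = 1 ∧ e = segment ℝ (gridPoint Z a) (gridPoint Z b)}

/-- The height at which a point appears on the view screen, the product of the vertical axis and
the square `|x| + |y| = 1`. -/
noncomputable def screenHeight (p : Point) : ℝ := p.2.2 / (|p.1| + |p.2.1|)

/-- The point `p` appears on the view screen at horizontal parameter `t ∈ [0, 4]`. The parameter
runs along the square `|x| + |y| = 1` from `(1, 0)` through the south to `(-1, 0)` for
`t ∈ [0, 2]`, and back through the north to `(1, 0)` for `t ∈ [2, 4]`. -/
def AppearsAt (t : ℝ) (p : Point) : Prop :=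
  (t ∈ Set.Icc (0 : ℝ) 2 ∧ p.1 / (|p.1| + |p.2.1|) = 1 - t ∧ p.2.1 ≤ 0) ∨
  (t ∈ Set.Icc (2 : ℝ) 4 ∧ p.1 / (|p.1| + |p.2.1|) = t - 3 ∧ 0 ≤ p.2.1)

/-- The heights at which points of the edges in `S` appear on the view screen at parameter `t`. -/
def heightsAt (S : Set (Set Point)) (t : ℝ) : Set ℝ :=
  {h | ∃ e ∈ S, ∃ p ∈ e, AppearsAt t p ∧ h = screenHeight p}

/-- The horizon of `S`: the upper envelope of the projections of its edges on the view screen. -/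
noncomputable def horizon (S : Set (Set Point)) (t : ℝ) : ℝ := sSup (heightsAt S t)

/-- The horizon of `S` is composed of `k` pieces: `[0, 4]` is cut into `k` intervals, on each of
which the horizon is part of the projection of a single edge of `S`. For edges that do not cross
the coordinate axes, as those of the layers, every piece is thus a line segment on the screen. -/
def HorizonHasPieces (S : Set (Set Point)) (k : ℕ) : Prop :=
  ∃ τ : Fin (k + 1) → ℝ, Monotone τ ∧ τ 0 = 0 ∧ τ (Fin.last k) = 4 ∧
    ∀ i : Fin k, ∃ e ∈ S, ∀ t ∈ Set.Icc (τ i.castSucc) (τ i.succ),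
      ∃ p ∈ e, AppearsAt t p ∧ screenHeight p = horizon S t

/-- The complexity of the horizon of `S`: the least number of pieces that compose it, and `⊤` if
finitely many do not suffice. -/
noncomputable def horizonComplexity (S : Set (Set Point)) : ℕ∞ :=
  sInf {c : ℕ∞ | ∃ k : ℕ, c = (k : ℕ∞) ∧ HorizonHasPieces S k}

end GridHorizon

namespace GridHorizon

open Set

/-! Treating the `O(l²)` edges as arbitrary segments would leave an inverse Ackermann factor from
the envelope bound. It disappears because the breakpoints of the layers are spread evenly. Within an
octant, let `w ∈ [0, 1/2]` be the offset from the axis on the screen. The vertices of layer `k`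
appear at `w = j / (k + j)`, and consecutive ones are at least `1 / (4k)` apart. So in each of the
`16 l` strips of width `1 / (4l)`, every layer shows at most two edges (`exists_break_in_strip`),
and these project to straight segments (`IsOctant.exists_edge`).

In one strip, the left parts all start on the same vertical line and the right parts all end on one.
The envelope of such segments has linear complexity (`exists_cuts_of_left_segments`): each segment
exceeds all the longer ones on a single interval. Between cuts for both families, one left line
competes with one right line, which adds at most one crossing (`exists_cuts_of_two_parts`). Thus
`O(l)` cuts suffice per strip, and `O(l²)` in all. -/

/-! ### Upper envelopes of segments with a common end line. -/

theorem Ioo_subset_of_ordConnected {s : Set ℝ} (hs : s.OrdConnected) (hb : BddBelow s)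
    (ha : BddAbove s) {u v x : ℝ} (hx : x ∈ Ioo u v) (hxs : x ∈ s) (hinf : sInf s ∉ Ioo u v)
    (hsup : sSup s ∉ Ioo u v) : Ioo u v ⊆ s := by
  intro y hy
  have h1 : sInf s ≤ u := by
    by_contra! h
    exact hinf ⟨h, (csInf_le hb hxs).trans_lt hx.2⟩
  have h2 : v ≤ sSup s := by
    by_contra! h
    exact hsup ⟨hx.1.trans_le (le_csSup ha hxs), h⟩
  obtain ⟨p, hp, hpy⟩ := exists_lt_of_csInf_lt ⟨x, hxs⟩ (h1.trans_lt hy.1)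
  obtain ⟨q, hq, hqy⟩ := exists_lt_of_lt_csSup ⟨x, hxs⟩ (hy.2.trans_le h2)
  exact hs.out hp hq ⟨hpy.le, hqy.le⟩

/-- The upper envelope of `n` segments that all start on the vertical line at `a` can be cut at
`3 n` places such that between the cuts, one segment is the topmost one. -/
theorem exists_cuts_of_left_segments {ι : Type*} (K : Finset ι) (a : ℝ) (b α β : ι → ℝ) :
    ∃ P : Finset ℝ, P.card ≤ 3 * K.card ∧ (∀ k ∈ K, b k ∈ P) ∧
      ∀ u v, a ≤ u → u < v → (∀ x ∈ P, x ∉ Ioo u v) → (∃ k ∈ K, v ≤ b k) →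
        ∃ k ∈ K, v ≤ b k ∧ ∀ j ∈ K, v ≤ b j → ∀ t ∈ Ioo u v, α j + β j * t ≤ α k + β k * t := by
  classical
  -- Only segments reaching at least as far as `k` compete here. On `[a, b k]` they are full affine
  -- functions, so `I k` is an interval.
  set I : ι → Set ℝ := fun k =>
    {t | a ≤ t ∧ t ≤ b k ∧ ∀ j ∈ K, b k ≤ b j → α j + β j * t ≤ α k + β k * t} with hI
  have hconn : ∀ k, (I k).OrdConnected := by
    intro k
    refine ⟨fun x hx y hy t ht => ⟨hx.1.trans ht.1, ht.2.trans hy.2.1, fun j hj hjk => ?_⟩⟩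
    have h1 := hx.2.2 j hj hjk
    have h2 := hy.2.2 j hj hjk
    rcases le_total (β j) (β k) with h | h
    · nlinarith [mul_nonneg (sub_nonneg.2 h) (sub_nonneg.2 ht.1)]
    · nlinarith [mul_nonneg (sub_nonneg.2 h) (sub_nonneg.2 ht.2)]
  have hbelow : ∀ k, BddBelow (I k) := fun k => ⟨a, fun t ht => ht.1⟩
  have habove : ∀ k, BddAbove (I k) := fun k => ⟨b k, fun t ht => ht.2.1⟩
  -- The places `b k` serve the later merging of left and right parts; the ends of the `I k` are
  -- what the envelope needs.
  refine ⟨K.image b ∪ K.image (fun k => sInf (I k)) ∪ K.image (fun k => sSup (I k)), ?_,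
    fun k hk => by simp only [Finset.mem_union, Finset.mem_image]; exact .inl (.inl ⟨k, hk, rfl⟩),
    ?_⟩
  · have h1 := Finset.card_union_le (K.image b ∪ K.image (fun k => sInf (I k)))
      (K.image (fun k => sSup (I k)))
    have h2 := Finset.card_union_le (K.image b) (K.image (fun k => sInf (I k)))
    have h3 := Finset.card_image_le (s := K) (f := b)
    have h4 := Finset.card_image_le (s := K) (f := fun k => sInf (I k))
    have h5 := Finset.card_image_le (s := K) (f := fun k => sSup (I k))
    omega
  · intro u v hau huv hP hne
    have hinf : ∀ k ∈ K, sInf (I k) ∉ Ioo u v := fun k hk => hP _ (by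
      simp only [Finset.mem_union, Finset.mem_image]; exact .inl (.inr ⟨k, hk, rfl⟩))
    have hsup : ∀ k ∈ K, sSup (I k) ∉ Ioo u v := fun k hk => hP _ (by
      simp only [Finset.mem_union, Finset.mem_image]; exact .inr ⟨k, hk, rfl⟩)
    have htop : ∀ t ∈ Ioo u v, ∃ k ∈ K, v ≤ b k ∧ Ioo u v ⊆ I k ∧
        ∀ j ∈ K, v ≤ b j → α j + β j * t ≤ α k + β k * t := by
      intro t ht
      obtain ⟨k, hk, hmax⟩ := (K.filter (fun k => v ≤ b k)).exists_max_image
        (fun k => α k + β k * t) (by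
          obtain ⟨k, hk, h⟩ := hne
          exact ⟨k, Finset.mem_filter.2 ⟨hk, h⟩⟩)
      rw [Finset.mem_filter] at hk
      refine ⟨k, hk.1, hk.2, ?_, fun j hj hjv => hmax j (Finset.mem_filter.2 ⟨hj, hjv⟩)⟩
      refine Ioo_subset_of_ordConnected (hconn k) (hbelow k) (habove k) ht ?_
        (hinf k hk.1) (hsup k hk.1)
      exact ⟨hau.trans ht.1.le, ht.2.le.trans hk.2, fun j hj hjk =>
        hmax j (Finset.mem_filter.2 ⟨hj, hk.2.trans hjk⟩)⟩
    -- The topmost segment found by `htop` may depend on `t`. The shortest `k` with `Ioo u v ⊆ I k`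
    -- dominates all these candidates, since each reaches at least as far as `k`.
    obtain ⟨k, hk, hmin⟩ := (K.filter (fun k => v ≤ b k ∧ Ioo u v ⊆ I k)).exists_min_image b (by
      obtain ⟨m, hm⟩ := exists_between huv
      obtain ⟨k, hk, hkv, hks, -⟩ := htop m hm
      exact ⟨k, Finset.mem_filter.2 ⟨hk, hkv, hks⟩⟩)
    rw [Finset.mem_filter] at hk
    refine ⟨k, hk.1, hk.2.1, fun j hj hjv t ht => ?_⟩
    obtain ⟨i, hi, hiv, his, himax⟩ := htop t ht
    exact (himax j hj hjv).trans
      ((hk.2.2 ht).2.2 i hi (hmin i (Finset.mem_filter.2 ⟨hi, hiv, his⟩)))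

/-- Mirror image of the left case under `t ↦ -t`. -/
theorem exists_cuts_of_right_segments {ι : Type*} (K : Finset ι) (c : ℝ) (b α β : ι → ℝ) :
    ∃ P : Finset ℝ, P.card ≤ 3 * K.card ∧
      ∀ u v, v ≤ c → u < v → (∀ x ∈ P, x ∉ Ioo u v) → (∃ k ∈ K, b k ≤ u) →
        ∃ k ∈ K, b k ≤ u ∧ ∀ j ∈ K, b j ≤ u → ∀ t ∈ Ioo u v, α j + β j * t ≤ α k + β k * t := by
  classical
  obtain ⟨P, hcard, -, hP⟩ := exists_cuts_of_left_segments K (-c) (fun k => -b k) α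
    (fun k => -β k)
  refine ⟨P.image (fun x => -x), Finset.card_image_le.trans hcard, fun u v hvc huv hfree hne => ?_⟩
  obtain ⟨k, hk, hku, hmax⟩ := hP (-v) (-u) (by linarith) (by linarith) (fun x hx hxuv =>
      hfree (-x) (Finset.mem_image_of_mem _ hx) ⟨by linarith [hxuv.2], by linarith [hxuv.1]⟩) (by
    obtain ⟨k, hk, h⟩ := hne
    exact ⟨k, hk, by linarith⟩)
  refine ⟨k, hk, by linarith, fun j hj hju t ht => ?_⟩
  have := hmax j hj (by linarith) (-t) ⟨by linarith [ht.2], by linarith [ht.1]⟩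
  linarith

/-- An affine function changes sign only at its root. For `B = 0` it is constant, so the default
value of the quotient does not matter. -/
theorem affine_nonneg_or_nonpos {A B u v : ℝ} (h : -A / B ∉ Ioo u v) :
    (∀ t ∈ Ioo u v, 0 ≤ A + B * t) ∨ (∀ t ∈ Ioo u v, A + B * t ≤ 0) := by
  rcases eq_or_ne B 0 with hB | hB
  · subst hB
    rcases le_total 0 A with hA | hA
    · exact .inl fun t _ => by linarith
    · exact .inr fun t _ => by linarith
  set x := -A / B with hx
  have hA : A = -(B * x) := by rw [hx]; field_simp
  have hcases : x ≤ u ∨ v ≤ x := by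
    by_contra! h'
    exact h ⟨h'.1, h'.2⟩
  rcases hcases with h1 | h1 <;> rcases hB.lt_or_gt with hB | hB
  · exact .inr fun t ht => by nlinarith [ht.1]
  · exact .inl fun t ht => by nlinarith [ht.1]
  · exact .inl fun t ht => by nlinarith [ht.2]
  · exact .inr fun t ht => by nlinarith [ht.2]

/-- The upper envelope of `n` functions on `[a, c]`, each of which consists of two affine parts,
can be cut at `16 n` places such that between the cuts, it consists of one part. -/
theorem exists_cuts_of_two_parts {ι : Type*} (K : Finset ι) (hK : K.Nonempty) {a c : ℝ}
    (f : ι → ℝ → ℝ) (b α β α' β' : ι → ℝ)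
    (hleft : ∀ k ∈ K, ∀ t ∈ Icc a (b k), f k t = α k + β k * t)
    (hright : ∀ k ∈ K, ∀ t ∈ Icc (b k) c, f k t = α' k + β' k * t) :
    ∃ P : Finset ℝ, P.card ≤ 16 * K.card ∧
      ∀ u v, a ≤ u → u < v → v ≤ c → (∀ x ∈ P, x ∉ Ioo u v) →
        ∃ k ∈ K, (v ≤ b k ∨ b k ≤ u) ∧ ∀ j ∈ K, ∀ t ∈ Icc u v, f j t ≤ f k t := by
  classical
  obtain ⟨P₁, hcard₁, hbP, hP₁⟩ := exists_cuts_of_left_segments K a b α β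
  obtain ⟨P₂, hcard₂, hP₂⟩ := exists_cuts_of_right_segments K c b α' β'
  set P := P₁ ∪ P₂ ∪ {a, c} with hPdef
  -- One extra cut `x` per gap of `P`, depending only on the gap's left end `p`; hence at most
  -- `P.card` extra cuts. Including `a` and `c` in `P` guarantees both neighbours of a gap.
  have hgap : ∀ p, ∃ x, ∀ u v, a ≤ p → p ≤ u → u < v → v ≤ c → (∀ y ∈ P, y ∉ Ioo p v) →
      x ∉ Ioo u v → ∃ k ∈ K, (v ≤ b k ∨ b k ≤ u) ∧ ∀ j ∈ K, ∀ t ∈ Ioo u v, f j t ≤ f k t := by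
    intro p
    by_cases hpc : p < c ∧ a ≤ p
    swap
    · exact ⟨0, fun u v hap hpu huv hvc => absurd ⟨by linarith, hap⟩ hpc⟩
    obtain ⟨hpc, hap⟩ := hpc
    obtain ⟨q, hq, hqmin⟩ := (P.filter (fun y => p < y)).exists_min_image id
      ⟨c, by simp [hPdef, hpc]⟩
    rw [Finset.mem_filter] at hq
    have hqc : q ≤ c := hqmin c (by simp [hPdef, hpc])
    have hfree : ∀ y ∈ P, y ∉ Ioo p q := fun y hy hyq =>
      absurd (hqmin y (Finset.mem_filter.2 ⟨hy, hyq.1⟩)) (not_le.2 hyq.2)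
    have hvq : ∀ v, (∀ y ∈ P, y ∉ Ioo p v) → v ≤ q := fun v hv => by
      by_contra! h
      exact hv q hq.1 ⟨hq.2, h⟩
    have hside : ∀ k ∈ K, q ≤ b k ∨ b k ≤ p := fun k hk => by
      by_contra! h
      exact hfree (b k) (by simp [hPdef, hbP k hk]) ⟨h.2, h.1⟩
    have hl := hP₁ p q hap hq.2 (fun y hy => hfree y (by simp [hPdef, hy]))
    have hr := hP₂ p q hqc hq.2 (fun y hy => hfree y (by simp [hPdef, hy]))
    have hfl : ∀ k ∈ K, q ≤ b k → ∀ t ∈ Ioo p q, f k t = α k + β k * t := fun k hk hkq t ht =>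
      hleft k hk t ⟨hap.trans ht.1.le, ht.2.le.trans hkq⟩
    have hfr : ∀ k ∈ K, b k ≤ p → ∀ t ∈ Ioo p q, f k t = α' k + β' k * t := fun k hk hkq t ht =>
      hright k hk t ⟨hkq.trans ht.1.le, ht.2.le.trans hqc⟩
    by_cases hL : ∃ k ∈ K, q ≤ b k
    · obtain ⟨k, hk, hkq, hkmax⟩ := hl hL
      by_cases hR : ∃ k ∈ K, b k ≤ p
      · obtain ⟨m, hm, hmp, hmmax⟩ := hr hR
        -- The crossing of the top left line with the top right line.
        refine ⟨-(α k - α' m) / (β k - β' m), fun u v _ hpu huv hvc hv hx => ?_⟩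
        have hvq := hvq v hv
        have hsub : ∀ t ∈ Ioo u v, t ∈ Ioo p q := fun t ht =>
          ⟨hpu.trans_lt ht.1, ht.2.trans_le hvq⟩
        rcases affine_nonneg_or_nonpos hx with h | h
        · refine ⟨k, hk, .inl (hvq.trans hkq), fun j hj t ht => ?_⟩
          have ht' := hsub t ht
          rw [hfl k hk hkq t ht']
          rcases hside j hj with hjs | hjs
          · rw [hfl j hj hjs t ht']
            exact hkmax j hj hjs t ht'
          · rw [hfr j hj hjs t ht']
            linarith [hmmax j hj hjs t ht', h t ht]
        · refine ⟨m, hm, .inr (hmp.trans hpu), fun j hj t ht => ?_⟩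
          have ht' := hsub t ht
          rw [hfr m hm hmp t ht']
          rcases hside j hj with hjs | hjs
          · rw [hfl j hj hjs t ht']
            linarith [hkmax j hj hjs t ht', h t ht]
          · rw [hfr j hj hjs t ht']
            exact hmmax j hj hjs t ht'
      · refine ⟨0, fun u v _ hpu huv hvc hv _ => ?_⟩
        have hvq := hvq v hv
        refine ⟨k, hk, .inl (hvq.trans hkq), fun j hj t ht => ?_⟩
        have ht' : t ∈ Ioo p q := ⟨hpu.trans_lt ht.1, ht.2.trans_le hvq⟩
        have hjs := (hside j hj).resolve_right fun h => hR ⟨j, hj, h⟩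
        rw [hfl k hk hkq t ht', hfl j hj hjs t ht']
        exact hkmax j hj hjs t ht'
    · have hall : ∀ k ∈ K, b k ≤ p := fun k hk => (hside k hk).resolve_left fun h => hL ⟨k, hk, h⟩
      obtain ⟨k₀, hk₀⟩ := hK
      obtain ⟨m, hm, hmp, hmmax⟩ := hr ⟨k₀, hk₀, hall k₀ hk₀⟩
      refine ⟨0, fun u v _ hpu huv hvc hv _ => ?_⟩
      have hvq := hvq v hv
      refine ⟨m, hm, .inr (hmp.trans hpu), fun j hj t ht => ?_⟩
      have ht' : t ∈ Ioo p q := ⟨hpu.trans_lt ht.1, ht.2.trans_le hvq⟩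
      rw [hfr m hm hmp t ht', hfr j hj (hall j hj) t ht']
      exact hmmax j hj (hall j hj) t ht'
  choose g hg using hgap
  refine ⟨P ∪ P.image g, ?_, fun u v hau huv hvc hfree => ?_⟩
  -- `2 (3n + 3n + 2) = 12n + 4 ≤ 16n`, as `n ≥ 1`.
  · have h1 := Finset.card_union_le P (P.image g)
    have h2 := Finset.card_image_le (s := P) (f := g)
    have h3 := Finset.card_union_le (P₁ ∪ P₂) {a, c}
    have h4 := Finset.card_union_le P₁ P₂
    have h5 := Finset.card_le_two (a := a) (b := c)
    have h6 := hK.card_pos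
    rw [← hPdef] at h3
    omega
  · obtain ⟨p, hp, hpmax⟩ := (P.filter (fun y => y ≤ u)).exists_max_image id
      ⟨a, by simp [hPdef, hau]⟩
    have hap : a ≤ p := hpmax a (by simp [hPdef, hau])
    rw [Finset.mem_filter] at hp
    obtain ⟨k, hk, hks, hkmax⟩ := hg p u v hap hp.2 huv hvc (fun y hy hyv => by
        rcases le_or_gt y u with h | h
        · exact absurd (hpmax y (Finset.mem_filter.2 ⟨hy, h⟩)) (not_le.2 hyv.1)
        · exact hfree y (Finset.mem_union_left _ hy) ⟨h, hyv.2⟩)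
      (hfree _ (Finset.mem_union_right _ (Finset.mem_image_of_mem g hp.1)))
    -- No `b j` lies inside the gap, so each `f j` is affine on the closed interval and the
    -- comparison extends to its ends.
    have hcont : ∀ j ∈ K, ContinuousOn (f j) (closure (Ioo u v)) := by
      intro j hj
      rw [closure_Ioo huv.ne]
      have hjs : v ≤ b j ∨ b j ≤ u := by
        by_contra! h
        exact hfree (b j) (by simp [hPdef, hbP j hj]) ⟨h.2, h.1⟩
      rcases hjs with hjs | hjs
      · exact ContinuousOn.congr (f := fun t => α j + β j * t) (by fun_prop) fun t ht =>
          hleft j hj t ⟨hau.trans ht.1, ht.2.trans hjs⟩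
      · exact ContinuousOn.congr (f := fun t => α' j + β' j * t) (by fun_prop) fun t ht =>
          hright j hj t ⟨hjs.trans ht.1, ht.2.trans hvc⟩
    refine ⟨k, hk, hks, fun j hj t ht => ?_⟩
    exact le_on_closure (hkmax j hj) (hcont j hj) (hcont k hk) (by rwa [closure_Ioo huv.ne])

/-! ### The height of a layer as a function of the screen parameter. -/

/-- The elevation at `(x, y)` by bilinear interpolation in the cells of the grid. -/
noncomputable def bilinear (Z : ℤ → ℤ → ℝ) (x y : ℝ) : ℝ :=
  (1 - Int.fract (-y)) * ((1 - Int.fract x) * Z ⌊-y⌋ ⌊x⌋ + Int.fract x * Z ⌊-y⌋ (⌊x⌋ + 1)) +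
    Int.fract (-y) *
      ((1 - Int.fract x) * Z (⌊-y⌋ + 1) ⌊x⌋ + Int.fract x * Z (⌊-y⌋ + 1) (⌊x⌋ + 1))

/-- The point of the square `|x| + |y| = 1` with parameter `t`: first coordinate. -/
noncomputable def screenX (t : ℝ) : ℝ := if t ≤ 2 then 1 - t else t - 3

/-- The point of the square `|x| + |y| = 1` with parameter `t`: second coordinate. -/
noncomputable def screenY (t : ℝ) : ℝ := if t ≤ 2 then |1 - t| - 1 else 1 - |t - 3|

/-- The distance in the `L_1`-norm at which layer `k` is seen in direction `t`. -/
noncomputable def layerDist (k : ℕ) (t : ℝ) : ℝ := k / max |screenX t| |screenY t|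

/-- The height at which layer `k` appears on the screen at parameter `t`. -/
noncomputable def layerHeight (Z : ℤ → ℤ → ℝ) (k : ℕ) (t : ℝ) : ℝ :=
  bilinear Z (layerDist k t * screenX t) (layerDist k t * screenY t) / layerDist k t

theorem AppearsAt.eq_mul {t : ℝ} {p : Point} (h : AppearsAt t p) (hp : 0 < |p.1| + |p.2.1|) :
    p.1 = (|p.1| + |p.2.1|) * screenX t ∧ p.2.1 = (|p.1| + |p.2.1|) * screenY t := by
  set N := |p.1| + |p.2.1| with hN
  rcases h with ⟨ht, hx, hy⟩ | ⟨ht, hx, hy⟩ <;> rw [div_eq_iff hp.ne'] at hx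
  · have h1 : |p.1| = |1 - t| * N := by rw [hx, abs_mul, abs_of_pos hp]
    rw [abs_of_nonpos hy] at hN
    simp only [screenX, screenY, if_pos ht.2]
    constructor <;> linarith
  · have h1 : |p.1| = |t - 3| * N := by rw [hx, abs_mul, abs_of_pos hp]
    rw [abs_of_nonneg hy] at hN
    -- At `t = 2` the definitions take their first branch; both branches give `(-1, 0)` there.
    rcases eq_or_lt_of_le ht.1 with rfl | h2
    · norm_num [screenX, screenY] at *
      constructor <;> linarith
    · simp only [screenX, screenY, if_neg (not_le.2 h2)]
      constructor <;> linarith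

theorem bilinear_row (Z : ℤ → ℤ → ℝ) (i j : ℤ) {s : ℝ} (h0 : 0 ≤ s) (h1 : s ≤ 1) :
    bilinear Z (j + s) (-i) = (1 - s) * Z i j + s * Z i (j + 1) := by
  rcases h1.eq_or_lt with rfl | h1
  · have h : ((j : ℝ) + 1) = ((j + 1 : ℤ) : ℝ) := by push_cast; ring
    simp only [bilinear, neg_neg, h, Int.fract_intCast, Int.floor_intCast]
    ring
  · have h2 : ⌊s⌋ = 0 := Int.floor_eq_zero_iff.2 ⟨h0, h1⟩
    simp only [bilinear, neg_neg, Int.fract_intCast, Int.floor_intCast, Int.floor_intCast_add, h2,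
      Int.fract_intCast_add, Int.fract_eq_self.2 ⟨h0, h1⟩, add_zero]
    ring

theorem bilinear_col (Z : ℤ → ℤ → ℝ) (i j : ℤ) {s : ℝ} (h0 : 0 ≤ s) (h1 : s ≤ 1) :
    bilinear Z j (-(i + s)) = (1 - s) * Z i j + s * Z (i + 1) j := by
  rcases h1.eq_or_lt with rfl | h1
  · have h : ((i : ℝ) + 1) = ((i + 1 : ℤ) : ℝ) := by push_cast; ring
    simp only [bilinear, neg_neg, h, Int.fract_intCast, Int.floor_intCast]
    ring
  · have h2 : ⌊s⌋ = 0 := Int.floor_eq_zero_iff.2 ⟨h0, h1⟩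
    simp only [bilinear, neg_neg, Int.fract_intCast, Int.floor_intCast, Int.floor_intCast_add, h2,
      Int.fract_intCast_add, Int.fract_eq_self.2 ⟨h0, h1⟩, add_zero]
    ring

theorem adjacent_cases {a b : ℤ × ℤ} (h : |a.1 - b.1| + |a.2 - b.2| = 1) :
    (a.1 = b.1 ∧ (b.2 = a.2 + 1 ∨ a.2 = b.2 + 1)) ∨
      (a.2 = b.2 ∧ (b.1 = a.1 + 1 ∨ a.1 = b.1 + 1)) := by
  rw [Int.abs_eq_natAbs, Int.abs_eq_natAbs] at h
  omega

/-- Along a grid line bilinear interpolation is linear between vertices. It thus provides one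
elevation function of the horizontal position that fits all edges at once. -/
theorem eq_bilinear_of_mem_segment {Z : ℤ → ℤ → ℝ} {a b : ℤ × ℤ}
    (h : |a.1 - b.1| + |a.2 - b.2| = 1) {p : Point}
    (hp : p ∈ segment ℝ (gridPoint Z a) (gridPoint Z b)) : p.2.2 = bilinear Z p.1 p.2.1 := by
  obtain ⟨i, j⟩ := a
  obtain ⟨i', j'⟩ := b
  obtain ⟨r, s, hr, hs, hrs, rfl⟩ := hp
  obtain rfl : r = 1 - s := by linarith
  have hs1 : s ≤ 1 := by linarith
  have hr1 : 1 - s ≤ 1 := by linarith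
  rcases adjacent_cases h with ⟨h1, h2 | h2⟩ | ⟨h1, h2 | h2⟩ <;> dsimp only at h1 h2 <;>
    subst h1 h2 <;> simp only [gridPoint, Prod.smul_mk, Prod.mk_add_mk, smul_eq_mul]
  · rw [← bilinear_row Z i j hs hs1]
    congr 1 <;> push_cast <;> ring
  · have := bilinear_row Z i j' hr hr1
    rw [sub_sub_cancel] at this
    rw [add_comm, ← this]
    congr 1 <;> push_cast <;> ring
  · rw [← bilinear_col Z i j hs hs1]
    congr 1 <;> push_cast <;> ring
  · have := bilinear_col Z i' j hr hr1
    rw [sub_sub_cancel] at this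
    rw [add_comm, ← this]
    congr 1 <;> push_cast <;> ring

theorem abs_convex_combination_le {x y r s M : ℝ} (hr : 0 ≤ r) (hs : 0 ≤ s) (hrs : r + s = 1)
    (hx : |x| ≤ M) (hy : |y| ≤ M) : |r * x + s * y| ≤ M := by
  rw [abs_le] at *
  constructor <;> nlinarith

/-- The coordinate shared by the two ends has absolute value `k`: otherwise the other coordinate
would have it at both ends, impossible for consecutive integers. -/
theorem max_abs_of_mem_segment {Z : ℤ → ℤ → ℝ} {a b : ℤ × ℤ} {k : ℕ}
    (h : |a.1 - b.1| + |a.2 - b.2| = 1) (ha : layerIndex a = k) (hb : layerIndex b = k) {p : Point}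
    (hp : p ∈ segment ℝ (gridPoint Z a) (gridPoint Z b)) : max |p.1| |p.2.1| = k := by
  obtain ⟨i, j⟩ := a
  obtain ⟨i', j'⟩ := b
  obtain ⟨r, s, hr, hs, hrs, rfl⟩ := hp
  simp only [layerIndex] at ha hb
  have hcast : ∀ x : ℤ, x.natAbs ≤ k → |(x : ℝ)| ≤ k := fun x hx => by
    rw [← Int.cast_abs, Int.abs_eq_natAbs]
    exact_mod_cast hx
  have hcast' : ∀ x : ℤ, x.natAbs = k → |(x : ℝ)| = k := fun x hx => by
    rw [← Int.cast_abs, Int.abs_eq_natAbs]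
    exact_mod_cast hx
  simp only [gridPoint, Prod.smul_mk, Prod.mk_add_mk, smul_eq_mul]
  rcases adjacent_cases h with ⟨h1, h2⟩ | ⟨h1, h2⟩ <;> dsimp only at h1 h2 <;> subst h1
  · have e : r * -(i : ℝ) + s * -(i : ℝ) = -i := by linear_combination -(i : ℝ) * hrs
    rw [e, abs_neg, hcast' i (by omega)]
    exact max_eq_right (abs_convex_combination_le hr hs hrs (hcast _ (by omega))
      (hcast _ (by omega)))
  · have e : r * (j : ℝ) + s * (j : ℝ) = j := by linear_combination (j : ℝ) * hrs
    rw [e, hcast' j (by omega)]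
    exact max_eq_left (abs_convex_combination_le hr hs hrs
      (by rw [abs_neg]; exact hcast _ (by omega)) (by rw [abs_neg]; exact hcast _ (by omega)))

/-- All points of layer `k` that appear at the same parameter appear at the same height. -/
theorem screenHeight_eq_layerHeight {Z : ℤ → ℤ → ℝ} {a b : ℤ × ℤ} {k : ℕ} (hk : 1 ≤ k)
    (h : |a.1 - b.1| + |a.2 - b.2| = 1) (ha : layerIndex a = k) (hb : layerIndex b = k) {p : Point}
    (hp : p ∈ segment ℝ (gridPoint Z a) (gridPoint Z b)) {t : ℝ} (ht : AppearsAt t p) :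
    screenHeight p = layerHeight Z k t := by
  have hmax := max_abs_of_mem_segment h ha hb hp
  have hk' : (1 : ℝ) ≤ k := by exact_mod_cast hk
  have hpos : 0 < |p.1| + |p.2.1| := by
    have : max |p.1| |p.2.1| ≤ |p.1| + |p.2.1| :=
      max_le (by linarith [abs_nonneg p.2.1]) (by linarith [abs_nonneg p.1])
    linarith
  obtain ⟨h1, h2⟩ := ht.eq_mul hpos
  have hdist : layerDist k t = |p.1| + |p.2.1| := by
    have e : (k : ℝ) = (|p.1| + |p.2.1|) * max |screenX t| |screenY t| := by
      rw [← hmax, mul_max_of_nonneg _ _ hpos.le]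
      congr 1
      · conv_lhs => rw [h1, abs_mul, abs_of_pos hpos]
      · conv_lhs => rw [h2, abs_mul, abs_of_pos hpos]
    have hne : max |screenX t| |screenY t| ≠ 0 := by
      intro h0
      rw [h0] at e
      linarith
    rw [layerDist, div_eq_iff hne, e]
  rw [screenHeight, layerHeight, hdist, ← h1, ← h2, eq_bilinear_of_mem_segment h hp]

/-! ### Edges of one layer within an octant. -/

/-- The unit vectors `(x₁, y₁)` and `(x₂, y₂)` point along different coordinate axes. -/
def IsAxisPair (x₁ y₁ x₂ y₂ : ℤ) : Prop :=
  ((x₁ = 1 ∨ x₁ = -1) ∧ y₁ = 0 ∧ x₂ = 0 ∧ (y₂ = 1 ∨ y₂ = -1)) ∨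
    (x₁ = 0 ∧ (y₁ = 1 ∨ y₁ = -1) ∧ (x₂ = 1 ∨ x₂ = -1) ∧ y₂ = 0)

/-- The directions `(1 - w) (x₁, y₁) + w (x₂, y₂)`, where `w ∈ [0, 1 / 2]`, have the parameters
`c + σ w`. -/
def IsOctant (c σ : ℝ) (x₁ y₁ x₂ y₂ : ℤ) : Prop :=
  IsAxisPair x₁ y₁ x₂ y₂ ∧ ∀ w ∈ Icc (0 : ℝ) (1 / 2), ∀ r > 0, ∀ p : Point,
    p.1 = r * ((1 - w) * x₁ + w * x₂) → p.2.1 = r * ((1 - w) * y₁ + w * y₂) →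
      AppearsAt (c + σ * w) p

theorem IsAxisPair.abs_add_abs {x₁ y₁ x₂ y₂ : ℤ} (h : IsAxisPair x₁ y₁ x₂ y₂) {w : ℝ}
    (hw : w ∈ Icc (0 : ℝ) (1 / 2)) {r : ℝ} (hr : 0 < r) :
    |r * ((1 - w) * x₁ + w * x₂)| + |r * ((1 - w) * y₁ + w * y₂)| = r := by
  have h0 : |r| = r := abs_of_pos hr
  have h1 : |w| = w := abs_of_nonneg hw.1
  have h2 : |1 - w| = 1 - w := abs_of_nonneg (by linarith [hw.2])
  rcases h with ⟨rfl | rfl, rfl, rfl, rfl | rfl⟩ | ⟨rfl, rfl | rfl, rfl | rfl, rfl⟩ <;>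
    · push_cast
      simp only [mul_zero, add_zero, zero_add, mul_one, mul_neg, abs_neg, abs_mul, h0, h1, h2]
      ring

theorem isOctant_of_appearsAt {c σ : ℝ} {x₁ y₁ x₂ y₂ : ℤ} (h : IsAxisPair x₁ y₁ x₂ y₂)
    (ht : ∀ w ∈ Icc (0 : ℝ) (1 / 2),
      (c + σ * w ∈ Icc (0 : ℝ) 2 ∧ (1 - w) * x₁ + w * x₂ = 1 - (c + σ * w) ∧
        (1 - w) * y₁ + w * y₂ ≤ 0) ∨
      (c + σ * w ∈ Icc (2 : ℝ) 4 ∧ (1 - w) * x₁ + w * x₂ = (c + σ * w) - 3 ∧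
        0 ≤ (1 - w) * y₁ + w * y₂)) :
    IsOctant c σ x₁ y₁ x₂ y₂ := by
  refine ⟨h, fun w hw r hr p hx hy => ?_⟩
  have hN : |p.1| + |p.2.1| = r := by rw [hx, hy]; exact h.abs_add_abs hw hr
  rw [AppearsAt, hN, hx, hy, mul_div_cancel_left₀ _ hr.ne']
  rcases ht w hw with ⟨h1, h2, h3⟩ | ⟨h1, h2, h3⟩
  · exact .inl ⟨h1, h2, mul_nonpos_of_nonneg_of_nonpos hr.le h3⟩
  · exact .inr ⟨h1, h2, mul_nonneg hr.le h3⟩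

/-- Since `w` is measured from an axis, which bounds the octant at its lower end for even `m` and at
its upper end for odd `m`, the orientations alternate. -/
theorem exists_isOctant {m : ℕ} (hm : m < 8) : ∃ x₁ y₁ x₂ y₂ : ℤ,
    IsOctant ((m : ℝ) / 2) 1 x₁ y₁ x₂ y₂ ∨ IsOctant (((m : ℝ) + 1) / 2) (-1) x₁ y₁ x₂ y₂ := by
  interval_cases m
  · exact ⟨1, 0, 0, -1, .inl (isOctant_of_appearsAt (by simp [IsAxisPair]) fun w hw => .inl (by
      obtain ⟨h0, h1⟩ := hw
      push_cast
      refine ⟨⟨?_, ?_⟩, ?_, ?_⟩ <;> linarith))⟩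
  · exact ⟨0, -1, 1, 0, .inr (isOctant_of_appearsAt (by simp [IsAxisPair]) fun w hw => .inl (by
      obtain ⟨h0, h1⟩ := hw
      push_cast
      refine ⟨⟨?_, ?_⟩, ?_, ?_⟩ <;> linarith))⟩
  · exact ⟨0, -1, -1, 0, .inl (isOctant_of_appearsAt (by simp [IsAxisPair]) fun w hw => .inl (by
      obtain ⟨h0, h1⟩ := hw
      push_cast
      refine ⟨⟨?_, ?_⟩, ?_, ?_⟩ <;> linarith))⟩
  · exact ⟨-1, 0, 0, -1, .inr (isOctant_of_appearsAt (by simp [IsAxisPair]) fun w hw => .inl (by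
      obtain ⟨h0, h1⟩ := hw
      push_cast
      refine ⟨⟨?_, ?_⟩, ?_, ?_⟩ <;> linarith))⟩
  · exact ⟨-1, 0, 0, 1, .inl (isOctant_of_appearsAt (by simp [IsAxisPair]) fun w hw => .inr (by
      obtain ⟨h0, h1⟩ := hw
      push_cast
      refine ⟨⟨?_, ?_⟩, ?_, ?_⟩ <;> linarith))⟩
  · exact ⟨0, 1, -1, 0, .inr (isOctant_of_appearsAt (by simp [IsAxisPair]) fun w hw => .inr (by
      obtain ⟨h0, h1⟩ := hw
      push_cast
      refine ⟨⟨?_, ?_⟩, ?_, ?_⟩ <;> linarith))⟩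
  · exact ⟨0, 1, 1, 0, .inl (isOctant_of_appearsAt (by simp [IsAxisPair]) fun w hw => .inr (by
      obtain ⟨h0, h1⟩ := hw
      push_cast
      refine ⟨⟨?_, ?_⟩, ?_, ?_⟩ <;> linarith))⟩
  · exact ⟨1, 0, 0, 1, .inr (isOctant_of_appearsAt (by simp [IsAxisPair]) fun w hw => .inr (by
      obtain ⟨h0, h1⟩ := hw
      push_cast
      refine ⟨⟨?_, ?_⟩, ?_, ?_⟩ <;> linarith))⟩

/-- On `[a, b]`, the function `f` is affine and part of the projection of one segment of `S`. -/
def IsPart (S : Set (Set Point)) (f : ℝ → ℝ) (a b : ℝ) : Prop :=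
  ∃ e ∈ S, ∃ A B : ℝ, ∀ t ∈ Icc a b,
    f t = A + B * t ∧ ∃ p ∈ e, AppearsAt t p ∧ screenHeight p = f t

/-- The grid position at distance `k` from the viewpoint along the first axis and at distance `j`
along the second axis. -/
def octantPos (x₁ y₁ x₂ y₂ k j : ℤ) : ℤ × ℤ := (-(k * y₁ + j * y₂), k * x₁ + j * x₂)

theorem IsAxisPair.layerIndex_octantPos {x₁ y₁ x₂ y₂ : ℤ} (h : IsAxisPair x₁ y₁ x₂ y₂) {k : ℕ}
    {j : ℤ} (h0 : 0 ≤ j) (hj : j ≤ k) : layerIndex (octantPos x₁ y₁ x₂ y₂ k j) = k := by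
  rcases h with ⟨rfl | rfl, rfl, rfl, rfl | rfl⟩ | ⟨rfl, rfl | rfl, rfl | rfl, rfl⟩ <;>
    · simp only [layerIndex, octantPos]
      omega

theorem IsAxisPair.adjacent_octantPos {x₁ y₁ x₂ y₂ : ℤ} (h : IsAxisPair x₁ y₁ x₂ y₂) (k j : ℤ) :
    |(octantPos x₁ y₁ x₂ y₂ k j).1 - (octantPos x₁ y₁ x₂ y₂ k (j + 1)).1| +
      |(octantPos x₁ y₁ x₂ y₂ k j).2 - (octantPos x₁ y₁ x₂ y₂ k (j + 1)).2| = 1 := by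
  rcases h with ⟨rfl | rfl, rfl, rfl, rfl | rfl⟩ | ⟨rfl, rfl | rfl, rfl | rfl, rfl⟩ <;>
    · simp only [octantPos, Int.abs_eq_natAbs]
      omega

/-- A point at offset `j + s` along its side has `L₁`-norm `k / (1 - w)`, where `(j + s) (1 - w) = k
w`. Dividing its elevation, affine in `s`, by this norm leaves a function affine in `w`. -/
theorem IsOctant.exists_edge {c σ : ℝ} {x₁ y₁ x₂ y₂ : ℤ} (h : IsOctant c σ x₁ y₁ x₂ y₂)
    (Z : ℤ → ℤ → ℝ) {k l : ℕ} (hk : 1 ≤ k) (hkl : k ≤ l) {j : ℕ} (hj : j < k) :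
    ∃ e ∈ layerEdges Z l, ∃ A B : ℝ, ∀ w ∈ Icc ((j : ℝ) / (k + j)) ((j + 1) / (k + j + 1)),
      layerHeight Z k (c + σ * w) = A + B * w ∧
      ∃ p ∈ e, AppearsAt (c + σ * w) p ∧ screenHeight p = layerHeight Z k (c + σ * w) := by
  have hadj := h.1.adjacent_octantPos k j
  have hla := h.1.layerIndex_octantPos (k := k) (j := j) (by omega) (by omega)
  have hlb := h.1.layerIndex_octantPos (k := k) (j := j + 1) (by omega) (by omega)
  set a := octantPos x₁ y₁ x₂ y₂ k j with ha
  set b := octantPos x₁ y₁ x₂ y₂ k (j + 1) with hb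
  set ζ := Z a.1 a.2 with hζ
  set η := Z b.1 b.2 with hη
  have hk0 : (1 : ℝ) ≤ k := by exact_mod_cast hk
  have hj0 : (0 : ℝ) ≤ j := by positivity
  have hjk : (j : ℝ) + 1 ≤ k := by exact_mod_cast hj
  refine ⟨segment ℝ (gridPoint Z a) (gridPoint Z b), ⟨a, b, by omega, by omega, by omega, hadj,
    rfl⟩, (ζ - j * (η - ζ)) / k, (η - ζ) - (ζ - j * (η - ζ)) / k, fun w hw => ?_⟩
  have hw1 : j ≤ w * (k + j) := (div_le_iff₀ (by linarith)).1 hw.1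
  have hw2 : w * (k + j + 1) ≤ j + 1 := (le_div_iff₀ (by linarith)).1 hw.2
  have hw0 : 0 ≤ w := le_trans (by positivity) hw.1
  have hwh : w ≤ 1 / 2 := by nlinarith
  have hw' : 0 < 1 - w := by linarith
  set s := k * w / (1 - w) - j with hs
  have hsw : (j + s) * (1 - w) = k * w := by rw [hs]; field_simp; ring
  have hs0 : 0 ≤ s := by
    rw [hs, sub_nonneg, le_div_iff₀ hw']
    linarith
  have hs1 : s ≤ 1 := by
    rw [hs, sub_le_iff_le_add, div_le_iff₀ hw']
    linarith
  have hr : 0 < (k : ℝ) / (1 - w) := by positivity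
  set p : Point := (1 - s) • gridPoint Z a + s • gridPoint Z b with hp
  have hmem : p ∈ segment ℝ (gridPoint Z a) (gridPoint Z b) :=
    ⟨1 - s, s, by linarith, hs0, by ring, rfl⟩
  have hw'' : (j + s) = k / (1 - w) * w := by field_simp; linarith
  have hkw : (k : ℝ) = k / (1 - w) * (1 - w) := by field_simp
  have hp1 : p.1 = k / (1 - w) * ((1 - w) * x₁ + w * x₂) := by
    have e : p.1 = k * x₁ + (j + s) * x₂ := by
      simp only [hp, gridPoint, ha, hb, octantPos, Prod.fst_add, Prod.smul_fst, smul_eq_mul]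
      push_cast
      ring
    rw [e, hw'', mul_add, ← mul_assoc, ← hkw, mul_assoc]
  have hp2 : p.2.1 = k / (1 - w) * ((1 - w) * y₁ + w * y₂) := by
    have e : p.2.1 = k * y₁ + (j + s) * y₂ := by
      simp only [hp, gridPoint, ha, hb, octantPos, Prod.fst_add, Prod.smul_fst, Prod.snd_add,
        Prod.smul_snd, smul_eq_mul]
      push_cast
      ring
    rw [e, hw'', mul_add, ← mul_assoc, ← hkw, mul_assoc]
  have happ := h.2 w ⟨hw0, hwh⟩ _ hr p hp1 hp2
  have hheight := screenHeight_eq_layerHeight hk hadj hla hlb hmem happ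
  refine ⟨?_, p, hmem, happ, hheight⟩
  have e : p.2.2 = (1 - s) * ζ + s * η := by
    simp only [hp, gridPoint, Prod.snd_add, Prod.smul_snd, smul_eq_mul, hζ, hη]
  rw [← hheight, screenHeight, hp1, hp2, h.1.abs_add_abs ⟨hw0, hwh⟩ hr, e]
  field_simp
  linear_combination (η - ζ) * hsw

/-- In the directions of a part of length at most `1 / (4 k)` of an octant, at most two edges of
layer `k` are seen. -/
theorem IsOctant.exists_break {c σ : ℝ} {x₁ y₁ x₂ y₂ : ℤ} (h : IsOctant c σ x₁ y₁ x₂ y₂)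
    (Z : ℤ → ℤ → ℝ) {k l : ℕ} (hk : 1 ≤ k) (hkl : k ≤ l) {v w : ℝ} (hv : 0 ≤ v) (hvw : v < w)
    (hw : w ≤ 1 / 2) (hlen : (w - v) * (4 * k) ≤ 1) :
    ∃ b ∈ Icc v w,
      (∃ e ∈ layerEdges Z l, ∃ A B : ℝ, ∀ x ∈ Icc v b,
        layerHeight Z k (c + σ * x) = A + B * x ∧
        ∃ p ∈ e, AppearsAt (c + σ * x) p ∧ screenHeight p = layerHeight Z k (c + σ * x)) ∧
      (∃ e ∈ layerEdges Z l, ∃ A B : ℝ, ∀ x ∈ Icc b w,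
        layerHeight Z k (c + σ * x) = A + B * x ∧
        ∃ p ∈ e, AppearsAt (c + σ * x) p ∧ screenHeight p = layerHeight Z k (c + σ * x)) := by
  have hk0 : (1 : ℝ) ≤ k := by exact_mod_cast hk
  have hv' : 0 < 1 - v := by linarith
  -- The offset on the side of the square seen at `v`; its floor selects the edge there.
  set j := ⌊(k : ℝ) * v / (1 - v)⌋₊ with hj
  have h1 : (j : ℝ) ≤ k * v / (1 - v) := Nat.floor_le (by positivity)
  have h2 : (k : ℝ) * v / (1 - v) < j + 1 := Nat.lt_floor_add_one _
  have hj0 : (0 : ℝ) ≤ j := by positivity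
  rw [le_div_iff₀ hv'] at h1
  rw [div_lt_iff₀ hv'] at h2
  have hjk : j < k := by
    have : (j : ℝ) < k := by nlinarith
    exact_mod_cast this
  have hjv : (j : ℝ) / (k + j) ≤ v := by
    rw [div_le_iff₀ (by linarith)]
    linarith
  have hvj : v < ((j : ℝ) + 1) / (k + j + 1) := by
    rw [lt_div_iff₀ (by linarith)]
    linarith
  obtain ⟨e, he, A, B, hAB⟩ := h.exists_edge Z hk hkl hjk
  rcases le_or_gt w (((j : ℝ) + 1) / (k + j + 1)) with hwj | hwj
  -- Without a vertex in between, the break is put at `w` and the second part degenerates.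
  · exact ⟨w, ⟨hvw.le, le_rfl⟩,
      ⟨e, he, A, B, fun x hx => hAB x ⟨hjv.trans hx.1, hx.2.trans hwj⟩⟩,
      ⟨e, he, A, B, fun x hx => hAB x ⟨(hjv.trans hvw.le).trans hx.1, hx.2.trans hwj⟩⟩⟩
  · have hjk' : j + 1 < k := by
      have : (j : ℝ) + 1 < k := by
        have := (div_lt_iff₀ (by linarith)).1 (hwj.trans_le hw)
        linarith
      exact_mod_cast this
    have hjk2 : (j : ℝ) + 2 ≤ k := by exact_mod_cast hjk'
    obtain ⟨e', he', A', B', hAB'⟩ := h.exists_edge Z hk hkl hjk'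
    -- The next edge spans at least `1 / (4k)`, because `j + 2 ≤ k` makes both factors of the
    -- denominator at most `2k`; so `w` cannot pass it.
    have hwj' : w ≤ ((j : ℝ) + 1 + 1) / (k + (j + 1) + 1) := by
      have e1 : ((j : ℝ) + 1 + 1) / (k + (j + 1) + 1) - (j + 1) / (k + j + 1) =
          k / ((k + j + 1) * (k + j + 2)) := by
        field_simp
        ring
      have e2 : 1 / (4 * (k : ℝ)) ≤ k / ((k + j + 1) * (k + j + 2)) := by
        rw [div_le_div_iff₀ (by positivity) (by positivity)]
        nlinarith
      have e3 : w - v ≤ 1 / (4 * (k : ℝ)) := by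
        rw [le_div_iff₀ (by positivity)]
        exact hlen
      linarith
    refine ⟨((j : ℝ) + 1) / (k + j + 1), ⟨hvj.le, hwj.le⟩,
      ⟨e, he, A, B, fun x hx => hAB x ⟨hjv.trans hx.1, hx.2⟩⟩,
      ⟨e', he', A', B', fun x hx => hAB' x ⟨?_, ?_⟩⟩⟩
    · push_cast
      rw [← add_assoc]
      exact hx.1
    · push_cast
      exact hx.2.trans hwj'

/-! ### Strips, and the horizon as an envelope of layers. -/

/-- The strip number `i` of width `1 / (4 l)` contains at most one breakpoint of layer `k`. -/
theorem exists_break_in_strip (Z : ℤ → ℤ → ℝ) {k l : ℕ} (hk : 1 ≤ k) (hkl : k ≤ l) {i : ℕ}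
    (hi : i < 16 * l) : ∃ b ∈ Icc ((i : ℝ) / (4 * l)) ((i + 1) / (4 * l)),
      IsPart (layerEdges Z l) (layerHeight Z k) (i / (4 * l)) b ∧
      IsPart (layerEdges Z l) (layerHeight Z k) b ((i + 1) / (4 * l)) := by
  have hl : 0 < l := by omega
  have hl' : (0 : ℝ) < l := by exact_mod_cast hl
  have hkl' : (k : ℝ) ≤ l := by exact_mod_cast hkl
  -- An octant has width `1 / 2`, exactly `2l` strips, so strip `i` lies in octant `m`.
  set m := i / (2 * l) with hm
  have hm8 : m < 8 := by
    rw [hm, Nat.div_lt_iff_lt_mul (by omega)]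
    omega
  have hmi : 2 * l * m ≤ i := Nat.mul_div_le i (2 * l)
  have him : i + 1 ≤ 2 * l * (m + 1) := Nat.lt_mul_div_succ i (by omega)
  have hmi' : 2 * (l : ℝ) * m ≤ i := by exact_mod_cast hmi
  have him' : (i : ℝ) + 1 ≤ 2 * l * (m + 1) := by exact_mod_cast him
  have e1 : (m : ℝ) / 2 ≤ i / (4 * l) := by
    rw [div_le_div_iff₀ (by norm_num) (by positivity)]
    linarith
  have e2 : ((i : ℝ) + 1) / (4 * l) ≤ (m + 1) / 2 := by
    rw [div_le_div_iff₀ (by positivity) (by norm_num)]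
    linarith
  have e3 : ((i : ℝ) + 1) / (4 * l) - i / (4 * l) = 1 / (4 * l) := by ring
  have e4 : 1 / (4 * (l : ℝ)) * (4 * k) ≤ 1 := by
    rw [div_mul_eq_mul_div, div_le_one (by positivity)]
    linarith
  have e5 : 0 < 1 / (4 * (l : ℝ)) := by positivity
  set a := (i : ℝ) / (4 * l) with ha
  set d := ((i : ℝ) + 1) / (4 * l) with hd
  obtain ⟨x₁, y₁, x₂, y₂, h | h⟩ := exists_isOctant hm8
  · obtain ⟨b, hb, ⟨e, he, A, B, hAB⟩, ⟨e', he', A', B', hAB'⟩⟩ :=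
      h.exists_break Z hk hkl (v := a - m / 2) (w := d - m / 2) (by linarith) (by linarith)
        (by linarith) (by rw [sub_sub_sub_cancel_right, e3]; exact e4)
    have hsub : ∀ t : ℝ, (m : ℝ) / 2 + 1 * (t - m / 2) = t := fun t => by ring
    refine ⟨m / 2 + b, ⟨by linarith [hb.1], by linarith [hb.2]⟩,
      ⟨e, he, A - B * (m / 2), B, fun t ht => ?_⟩, ⟨e', he', A' - B' * (m / 2), B', fun t ht => ?_⟩⟩
    · have := hAB (t - m / 2) ⟨by linarith [ht.1], by linarith [ht.2]⟩
      rw [hsub] at this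
      exact ⟨by rw [this.1]; ring, this.2⟩
    · have := hAB' (t - m / 2) ⟨by linarith [ht.1], by linarith [ht.2]⟩
      rw [hsub] at this
      exact ⟨by rw [this.1]; ring, this.2⟩
  -- For `σ = -1` the parameter runs backwards, so the two parts swap.
  · obtain ⟨b, hb, ⟨e, he, A, B, hAB⟩, ⟨e', he', A', B', hAB'⟩⟩ :=
      h.exists_break Z hk hkl (v := (m + 1) / 2 - d) (w := (m + 1) / 2 - a) (by linarith)
        (by linarith) (by linarith) (by rw [sub_sub_sub_cancel_left, e3]; exact e4)
    have hsub : ∀ t : ℝ, ((m : ℝ) + 1) / 2 + -1 * ((m + 1) / 2 - t) = t := fun t => by ring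
    refine ⟨(m + 1) / 2 - b, ⟨by linarith [hb.2], by linarith [hb.1]⟩,
      ⟨e', he', A' + B' * ((m + 1) / 2), -B', fun t ht => ?_⟩,
      ⟨e, he, A + B * ((m + 1) / 2), -B, fun t ht => ?_⟩⟩
    · have := hAB' ((m + 1) / 2 - t) ⟨by linarith [ht.2], by linarith [ht.1]⟩
      rw [hsub] at this
      exact ⟨by rw [this.1]; ring, this.2⟩
    · have := hAB ((m + 1) / 2 - t) ⟨by linarith [ht.2], by linarith [ht.1]⟩
      rw [hsub] at this
      exact ⟨by rw [this.1]; ring, this.2⟩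

theorem exists_strip {l : ℕ} (hl : 0 < l) {t : ℝ} (h0 : 0 ≤ t) (h4 : t < 4) :
    ∃ i < 16 * l, (i : ℝ) / (4 * l) ≤ t ∧ t < ((i : ℝ) + 1) / (4 * l) := by
  have hl' : (0 : ℝ) < l := by exact_mod_cast hl
  have h1 := Nat.floor_le (show 0 ≤ t * (4 * l) by positivity)
  have h2 := Nat.lt_floor_add_one (t * (4 * l))
  refine ⟨⌊t * (4 * l)⌋₊, ?_, ?_, ?_⟩
  · rw [Nat.floor_lt (by positivity)]
    push_cast
    nlinarith
  · rwa [div_le_iff₀ (by positivity)]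
  · rwa [lt_div_iff₀ (by positivity)]

theorem exists_point_of_layer (Z : ℤ → ℤ → ℝ) {k l : ℕ} (hk : 1 ≤ k) (hkl : k ≤ l) {t : ℝ}
    (ht : t ∈ Icc (0 : ℝ) 4) :
    ∃ e ∈ layerEdges Z l, ∃ p ∈ e, AppearsAt t p ∧ screenHeight p = layerHeight Z k t := by
  have hl : 0 < l := by omega
  obtain ⟨i, hi, h1, h2⟩ : ∃ i < 16 * l, (i : ℝ) / (4 * l) ≤ t ∧ t ≤ ((i : ℝ) + 1) / (4 * l) := by
    rcases ht.2.lt_or_eq with h4 | rfl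
    · obtain ⟨i, hi, h1, h2⟩ := exists_strip hl ht.1 h4
      exact ⟨i, hi, h1, h2.le⟩
    · have hl' : (0 : ℝ) < l := by exact_mod_cast hl
      -- The endpoint `t = 4` belongs to the last closed strip.
      refine ⟨16 * l - 1, by omega, ?_, ?_⟩ <;> rw [Nat.cast_sub (by omega)] <;> push_cast
      · rw [div_le_iff₀ (by positivity)]
        linarith
      · rw [le_div_iff₀ (by positivity)]
        linarith
  obtain ⟨b, hb, ⟨e, he, A, B, hAB⟩, ⟨e', he', A', B', hAB'⟩⟩ := exists_break_in_strip Z hk hkl hi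
  rcases le_total t b with h | h
  · exact ⟨e, he, (hAB t ⟨h1, h⟩).2⟩
  · exact ⟨e', he', (hAB' t ⟨h, h2⟩).2⟩

/-- Each layer contributes exactly one height at `t`; the set is therefore finite and the maxima
exist. -/
theorem heightsAt_layerEdges (Z : ℤ → ℤ → ℝ) (l : ℕ) {t : ℝ} (ht : t ∈ Icc (0 : ℝ) 4) :
    heightsAt (layerEdges Z l) t = {h | ∃ k ∈ Finset.Icc 1 l, h = layerHeight Z k t} := by
  ext h
  constructor
  · rintro ⟨e, ⟨a, b, ha, hal, hb, hab, rfl⟩, p, hp, hpt, rfl⟩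
    exact ⟨layerIndex a, Finset.mem_Icc.2 ⟨ha, hal⟩,
      screenHeight_eq_layerHeight ha hab rfl hb hp hpt⟩
  · rintro ⟨k, hk, rfl⟩
    rw [Finset.mem_Icc] at hk
    obtain ⟨e, he, p, hp, hpt, hph⟩ := exists_point_of_layer Z hk.1 hk.2 ht
    exact ⟨e, he, p, hp, hpt, hph.symm⟩

theorem isGreatest_layerHeight (Z : ℤ → ℤ → ℝ) {k l : ℕ} (hk : k ∈ Finset.Icc 1 l) {t : ℝ}
    (ht : t ∈ Icc (0 : ℝ) 4)
    (hmax : ∀ j ∈ Finset.Icc 1 l, layerHeight Z j t ≤ layerHeight Z k t) :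
    IsGreatest (heightsAt (layerEdges Z l) t) (layerHeight Z k t) := by
  rw [heightsAt_layerEdges Z l ht]
  refine ⟨⟨k, hk, rfl⟩, ?_⟩
  rintro _ ⟨j, hj, rfl⟩
  exact hmax j hj

theorem isGreatest_horizon (Z : ℤ → ℤ → ℝ) {l : ℕ} (hl : 1 ≤ l) {t : ℝ}
    (ht : t ∈ Icc (0 : ℝ) 4) :
    IsGreatest (heightsAt (layerEdges Z l) t) (horizon (layerEdges Z l) t) := by
  obtain ⟨k, hk, hmax⟩ := (Finset.Icc 1 l).exists_max_image (fun k => layerHeight Z k t)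
    ⟨1, Finset.mem_Icc.2 ⟨le_rfl, hl⟩⟩
  have h := isGreatest_layerHeight Z hk ht hmax
  rwa [horizon, h.csSup_eq]

/-! ### Counting the pieces of the horizon. -/

theorem exists_cuts_of_strip (Z : ℤ → ℤ → ℝ) {l : ℕ} (hl : 1 ≤ l) {i : ℕ} (hi : i < 16 * l) :
    ∃ P : Finset ℝ, P.card ≤ 16 * l ∧
      ∀ u v, (i : ℝ) / (4 * l) ≤ u → u < v → v ≤ ((i : ℝ) + 1) / (4 * l) → 0 ≤ u → v ≤ 4 →
        (∀ x ∈ P, x ∉ Ioo u v) → ∃ e ∈ layerEdges Z l, ∀ t ∈ Icc u v,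
          ∃ p ∈ e, AppearsAt t p ∧ screenHeight p = horizon (layerEdges Z l) t := by
  have hbreak : ∀ k ∈ Finset.Icc 1 l, ∃ b ∈ Icc ((i : ℝ) / (4 * l)) ((i + 1) / (4 * l)),
      IsPart (layerEdges Z l) (layerHeight Z k) (i / (4 * l)) b ∧
      IsPart (layerEdges Z l) (layerHeight Z k) b ((i + 1) / (4 * l)) := fun k hk => by
    rw [Finset.mem_Icc] at hk
    exact exists_break_in_strip Z hk.1 hk.2 hi
  choose! b hb hbl hbr using hbreak
  choose! e he α β hαβ using hbl
  choose! e' he' α' β' hαβ' using hbr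
  obtain ⟨P, hcard, hP⟩ := exists_cuts_of_two_parts (Finset.Icc 1 l)
    ⟨1, Finset.mem_Icc.2 ⟨le_rfl, hl⟩⟩ (layerHeight Z) b α β α' β'
    (fun k hk t ht => (hαβ k hk t ht).1) (fun k hk t ht => (hαβ' k hk t ht).1)
  refine ⟨P, by simpa using hcard, fun u v hu huv hv h0 h4 hfree => ?_⟩
  obtain ⟨k, hk, hside, hmax⟩ := hP u v hu huv hv hfree
  have hhor : ∀ t ∈ Icc u v, horizon (layerEdges Z l) t = layerHeight Z k t := fun t ht =>
    (isGreatest_layerHeight Z hk ⟨h0.trans ht.1, ht.2.trans h4⟩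
      fun j hj => hmax j hj t ht).csSup_eq
  rcases hside with h | h
  · refine ⟨e k, he k hk, fun t ht => ?_⟩
    rw [hhor t ht]
    exact (hαβ k hk t ⟨hu.trans ht.1, ht.2.trans h⟩).2
  · refine ⟨e' k, he' k hk, fun t ht => ?_⟩
    rw [hhor t ht]
    exact (hαβ' k hk t ⟨h.trans ht.1, ht.2.trans hv⟩).2

theorem horizonHasPieces_of_cuts {S : Set (Set Point)} {P : Finset ℝ} (h0 : 0 ∈ P) (h4 : 4 ∈ P)
    (hsub : ∀ x ∈ P, x ∈ Icc (0 : ℝ) 4)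
    (hP : ∀ u v, 0 ≤ u → u < v → v ≤ 4 → (∀ x ∈ P, x ∉ Ioo u v) →
      ∃ e ∈ S, ∀ t ∈ Icc u v, ∃ p ∈ e, AppearsAt t p ∧ screenHeight p = horizon S t) :
    HorizonHasPieces S (P.card - 1) := by
  have hpos : 0 < P.card := Finset.card_pos.2 ⟨0, h0⟩
  have hcard : P.card = P.card - 1 + 1 := by omega
  set τ := P.orderEmbOfFin hcard with hτ
  have hmem : ∀ i, τ i ∈ P := fun i => P.orderEmbOfFin_mem hcard i
  have hsurj : ∀ x ∈ P, ∃ i, τ i = x := fun x hx => by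
    have : x ∈ Set.range τ := by
      rw [hτ, Finset.range_orderEmbOfFin]
      exact hx
    exact this
  refine ⟨τ, τ.monotone, le_antisymm ?_ (hsub _ (hmem 0)).1,
    le_antisymm (hsub _ (hmem _)).2 ?_, fun i => ?_⟩
  · obtain ⟨i, hi⟩ := hsurj 0 h0
    rw [← hi]
    exact τ.monotone (Fin.zero_le i)
  · obtain ⟨i, hi⟩ := hsurj 4 h4
    rw [← hi]
    exact τ.monotone (Fin.le_last i)
  · refine hP _ _ (hsub _ (hmem _)).1 (τ.strictMono i.castSucc_lt_succ) (hsub _ (hmem _)).2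
      fun x hx hxi => ?_
    obtain ⟨j, rfl⟩ := hsurj x hx
    have h1 := τ.lt_iff_lt.1 hxi.1
    have h2 := τ.lt_iff_lt.1 hxi.2
    rw [Fin.lt_def] at h1 h2
    simp at h1 h2
    omega

theorem horizonComplexity_layerEdges_le (Z : ℤ → ℤ → ℝ) {l : ℕ} (hl : 1 ≤ l) :
    horizonComplexity (layerEdges Z l) ≤ ((272 * l ^ 2 : ℕ) : ℕ∞) := by
  classical
  have hl' : (0 : ℝ) < l := by exact_mod_cast hl
  choose! P hcard hP using fun i (hi : i < 16 * l) => exists_cuts_of_strip Z hl hi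
  set E := (Finset.range (16 * l + 1)).image (fun i : ℕ => (i : ℝ) / (4 * l)) with hE
  have hEmem : ∀ i ≤ 16 * l, (i : ℝ) / (4 * l) ∈ E := fun i hi =>
    Finset.mem_image.2 ⟨i, Finset.mem_range.2 (by omega), rfl⟩
  -- Envelope cuts of all strips together with the strip boundaries; nothing confines the former to
  -- `[0, 4]`, hence the filter.
  set Q := ((Finset.range (16 * l)).biUnion P ∪ E).filter (fun x => x ∈ Icc (0 : ℝ) 4) with hQ
  have hpieces : HorizonHasPieces (layerEdges Z l) (Q.card - 1) := by
    refine horizonHasPieces_of_cuts ?_ ?_ (fun x hx => (Finset.mem_filter.1 hx).2) ?_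
    · refine Finset.mem_filter.2 ⟨Finset.mem_union_right _ ?_, by norm_num⟩
      simpa using hEmem 0 (by omega)
    · refine Finset.mem_filter.2 ⟨Finset.mem_union_right _ ?_, by norm_num⟩
      have h := hEmem (16 * l) le_rfl
      have e : ((16 * l : ℕ) : ℝ) / (4 * l) = 4 := by
        push_cast
        field_simp
        norm_num
      rwa [e] at h
    · intro u v h0 huv h4 hfree
      have hfree' : ∀ x ∈ (Finset.range (16 * l)).biUnion P ∪ E, x ∉ Ioo u v := fun x hx hxuv =>
        hfree x (Finset.mem_filter.2 ⟨hx, h0.trans hxuv.1.le, hxuv.2.le.trans h4⟩) hxuv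
      obtain ⟨i, hi, hiu, hui⟩ := exists_strip hl h0 (huv.trans_le h4)
      have hvi : v ≤ ((i : ℝ) + 1) / (4 * l) := by
        by_contra! h
        have := hEmem (i + 1) (by omega)
        push_cast at this
        exact hfree' _ (Finset.mem_union_right _ this) ⟨hui, h⟩
      exact hP i hi u v hiu huv hvi h0 h4 fun x hx => hfree' x
        (Finset.mem_union_left _ (Finset.mem_biUnion.2 ⟨i, Finset.mem_range.2 hi, hx⟩))
  have hcardQ : Q.card ≤ 16 * l * (16 * l) + (16 * l + 1) := by
    refine (Finset.card_filter_le _ _).trans ((Finset.card_union_le _ _).trans (add_le_add ?_ ?_))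
    · have := Finset.card_biUnion_le_card_mul (Finset.range (16 * l)) P (16 * l)
        fun i hi => hcard i (Finset.mem_range.1 hi)
      rwa [Finset.card_range] at this
    · exact Finset.card_image_le.trans (Finset.card_range _).le
  refine (sInf_le ⟨_, rfl, hpieces⟩ : horizonComplexity (layerEdges Z l) ≤ _).trans ?_
  norm_cast
  -- `16 l` strips with `16 l` cuts each, and `16 l + 1` boundaries. Finally `16 l ≤ 16 l²` gives
  -- the constant `272`.
  have : Q.card - 1 ≤ 256 * l ^ 2 + 16 * l := by
    have : 16 * l * (16 * l) = 256 * l ^ 2 := by ring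
    omega
  nlinarith

end GridHorizon

theorem theorem3 :
    ∃ C : ℕ, ∀ l : ℕ, 1 ≤ l → ∀ Z : ℤ → ℤ → ℝ,
      (∀ t ∈ Set.Icc (0 : ℝ) 4,
        IsGreatest (GridHorizon.heightsAt (GridHorizon.layerEdges Z l) t)
          (GridHorizon.horizon (GridHorizon.layerEdges Z l) t)) ∧
      GridHorizon.horizonComplexity (GridHorizon.layerEdges Z l) ≤ ((C * l ^ 2 : ℕ) : ℕ∞) :=
  ⟨272, fun _ hl Z => ⟨fun _ ht => GridHorizon.isGreatest_horizon Z hl ht,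
    GridHorizon.horizonComplexity_layerEdges_le Z hl⟩⟩
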